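/- Let $G=(V,E)$ be a finite simple graph with an arbitrary fixed orientation of each edge, and let $B:\mathbb{R}^E\to\mathbb{R}^V$ be its oriented incidence matrix, with entries $b_{i,(j,k)}=\delta_{ik}-\delta_{ij}$. Put $H_1(G)=\ker B\subseteq\mathbb{R}^E$. Let $f:\mathbb{R}\to\mathbb{R}$ be a non-constant, odd, real-analytic function, let $\mathbf{f}:\mathbb{R}^E\to\mathbb{R}^E$ apply $f$ to each coordinate, and let \[ \mathcal{E}(G,f)=\mathbf{f}^{-1}(H_1(G))\cap H_1(G)^{\perp} \] be the set of equilibria, up to translational symmetry, of the system $\dot x_i=\sum_{j\sim i}f(x_j-x_i)$, $i\in V$. The dimension $\dim X$ of a set $X\subseteq\mathbb{R}^E$ is the maximal dimension of a non-empty smooth (embedded) submanifold of $\mathbb{R}^E$ contained in $X$. A cycle chain of length $p$ in $G$ is a sequence $G_1,\dots,G_p$ of cycle subgraphs of $G$ such that $|E(G_j)\cap E(G_k)|=1$ if $|j-k|=1$ and $E(G_j)\cap E(G_k)=\emptyset$ if $|j-k|>1$; let $\operatorname{cc}(G)$ be the maximal length of a cycle chain in $G$ (with $\operatorname{cc}(G)=0$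 if $G$ has no cycle). Suppose that $f$ is periodic or has finite fibers, i.e. the preimage of every point is a finite set. Then \[ \dim\mathcal{E}(G,f)\le\dim H_1(G)-\operatorname{cc}(G)+1 . \] -/

import Mathlib

open scoped ContDiff

/-- The class of coupling functions: non-constant, odd, real-analytic functions `ℝ → ℝ`. -/
def OddAnalytic : Set (ℝ → ℝ) :=
  {f | (¬ ∃ c : ℝ, ∀ x, f x = c) ∧ Function.Odd f ∧ AnalyticOnNhd ℝ f Set.univ}

/-- `f` is periodic with some non-zero period. -/
def IsPeriodic (f : ℝ → ℝ) : Prop := ∃ P : ℝ, P ≠ 0 ∧ Function.Periodic f P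

/-- The preimage of every point under `f` is finite. -/
def HasFiniteFibers (f : ℝ → ℝ) : Prop := ∀ c : ℝ, (f ⁻¹' {c}).Finite

/-- `M` is an embedded smooth submanifold of dimension `d` of the normed space `E`: around each of
its points there is a smooth local coordinate system (diffeomorphism between open sets of `E`) that
maps `M` to a `d`-dimensional linear subspace. -/
def IsSmoothSubmanifold {E : Type*} [NormedAddCommGroup E] [NormedSpace ℝ E]
    (d : ℕ) (M : Set E) : Prop :=
  ∀ x ∈ M, ∃ (Φ : OpenPartialHomeomorph E E) (F : Submodule ℝ E),
    x ∈ Φ.source ∧ ContDiffOn ℝ ∞ Φ Φ.source ∧ ContDiffOn ℝ ∞ Φ.symm Φ.target ∧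
    FiniteDimensional ℝ F ∧ Module.finrank ℝ F = d ∧
    Φ '' (Φ.source ∩ M) = Φ.target ∩ (F : Set E)

/-- The dimension of a set `X`: the maximal dimension of a non-empty smooth manifold contained
in `X` (it is `⊥` for the empty set). -/
noncomputable def manifoldDim {E : Type*} [NormedAddCommGroup E] [NormedSpace ℝ E]
    (X : Set E) : WithBot ℕ∞ :=
  ⨆ (d : ℕ) (_ : ∃ M : Set E, M.Nonempty ∧ M ⊆ X ∧ IsSmoothSubmanifold d M),
    (((d : ℕ∞)) : WithBot ℕ∞)

namespace SimpleGraph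

variable {V : Type*}

/-- A choice of an orientation of each edge of `G`. -/
structure EdgeOrientation (G : SimpleGraph V) where
  /-- the initial vertex of an oriented edge -/
  src : G.edgeSet → V
  /-- the final vertex of an oriented edge -/
  tgt : G.edgeSet → V
  edge_eq : ∀ e, s(src e, tgt e) = (e : Sym2 V)

/-- The oriented incidence matrix `B`, with entries `b_{i,(j,k)} = δ_{ik} - δ_{ij}`. -/
def EdgeOrientation.incidence [DecidableEq V] {G : SimpleGraph V} (o : G.EdgeOrientation) :
    Matrix V G.edgeSet ℝ :=
  Matrix.of fun i e => (if i = o.tgt e then 1 else 0) - (if i = o.src e then 1 else 0)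

section

variable [Fintype V] [DecidableEq V] {G : SimpleGraph V} [DecidableRel G.Adj]

/-- The first homology group `H₁(G) = ker B`, a subspace of the edge space `ℝ^E`. -/
noncomputable def EdgeOrientation.homologyOne (o : G.EdgeOrientation) :
    Submodule ℝ (EuclideanSpace ℝ G.edgeSet) :=
  LinearMap.ker (Matrix.toEuclideanLin o.incidence)

/-- The set of equilibria up to symmetry, `𝐟⁻¹(H₁(G)) ∩ H₁(G)^⊥`, where `𝐟` applies `f` to every
coordinate. -/
def EdgeOrientation.equilibria (o : G.EdgeOrientation) (f : ℝ → ℝ) :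
    Set (EuclideanSpace ℝ G.edgeSet) :=
  {y | WithLp.toLp 2 (fun e => f (y e)) ∈ o.homologyOne ∧ y ∈ o.homologyOneᗮ}

end

/-- The subgraph `H` of `G` is a cycle graph (with at least three vertices), i.e. it consists of
the vertices and edges of a simple closed walk. -/
def Subgraph.IsCycleSubgraph {G : SimpleGraph V} (H : G.Subgraph) : Prop :=
  ∃ (v : V) (w : G.Walk v v), w.IsCycle ∧ w.toSubgraph = H

/-- A cycle chain of length `p` in `G`: a sequence of `p` cycles, consecutive ones sharing exactly
one edge and non-consecutive ones sharing none. -/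
structure IsCycleChain (G : SimpleGraph V) {p : ℕ} (C : Fin p → G.Subgraph) : Prop where
  isCycle : ∀ j, (C j).IsCycleSubgraph
  consecutive : ∀ j k : Fin p, (j : ℕ) + 1 = k → ((C j).edgeSet ∩ (C k).edgeSet).ncard = 1
  nonconsecutive : ∀ j k : Fin p, (j : ℕ) + 1 < k → (C j).edgeSet ∩ (C k).edgeSet = ∅

/-- The maximal length of a cycle chain contained in `G` (`0` if `G` has no cycles). -/
noncomputable def cc (G : SimpleGraph V) : ℕ∞ :=
  ⨆ (p : ℕ) (_ : ∃ C : Fin p → G.Subgraph, G.IsCycleChain C), (p : ℕ∞)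

end SimpleGraph

/-!
Let `M` be a submanifold of the set of equilibria, `x ∈ M`, and let `T` be the tangent space of `M`
at `x`. Differentiating the equations `y ∈ H₁ᗮ` and `𝐟(y) ∈ H₁` along curves in `M` gives `T ⊆ H₁ᗮ`
and `D T ⊆ H₁`, where `D` is the diagonal matrix with entries `f'(x e)`. If `x` is chosen so that
the number of edges with `f'(x e) ≠ 0` is maximal among the points of `M`, then an edge with
`f'(x e) = 0` has `f'(y e) = 0` for all `y ∈ M` near `x`. The zeros of `f'` are isolated, because `f`
is analytic and not constant, so `y e` is locally constant on `M` and `v e = 0` for all `v ∈ T`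
(`add_le_of_isSmoothSubmanifold`). Hence `D` is injective on `T`, and `dim T ≤ dim H₁`.

A cycle chain `G₁, …, G_p` improves this by `p - 1`. Let `z_k ∈ H₁` be the signed indicator vector
of `G_k` (`exists_cycleVector`). The map
`T × ℝ^(p-1) → H₁, (v, a) ↦ D v + a₂ z₂ + ⋯ + a_p z_p` is injective
(`finrank_add_le_of_chain_succ`). To see this, suppose that `(v, a)` is in its kernel and that
`a_k = 0` for all `k ≤ j`. On `G_j` the equation reads `f'(x e) v e + a_{j+1} z_{j+1}(e) = 0`, so `v`
vanishes on `G_j` outside of the edge that `G_j` shares with `G_{j+1}`. As `⟪z_j, v⟫ = 0`, it also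
vanishes on that edge, and therefore `a_{j+1} = 0`.
-/

open Filter Topology

/-! ### Linear algebra -/

/-- If the supports of `z 0, …, z q` in `H` meet as in a cycle chain, then a space `T ⊆ Hᗮ` that
the diagonal map `D` embeds into `H` has codimension at least `q`: the map
`T × ℝ^q → H, (v, a) ↦ D v + ∑ k, a k • z (k + 1)` is injective. -/
theorem finrank_add_le_of_chain_succ {ι : Type*} [Fintype ι]
    (H T : Submodule ℝ (EuclideanSpace ℝ ι)) (D : ι → ℝ) (hTH : T ≤ Hᗮ)
    (hDT : ∀ v ∈ T, WithLp.toLp 2 (fun e => D e * v e) ∈ H)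
    (hD : ∀ v ∈ T, ∀ e, D e = 0 → v e = 0)
    {q : ℕ} (z : Fin (q + 1) → EuclideanSpace ℝ ι) (hz : ∀ j, z j ∈ H)
    (hcons : ∀ j k : Fin (q + 1), (j : ℕ) + 1 = k →
      ∃ e, z j e ≠ 0 ∧ z k e ≠ 0 ∧ ∀ e', z j e' ≠ 0 → z k e' ≠ 0 → e' = e)
    (hnon : ∀ j k : Fin (q + 1), (j : ℕ) + 1 < k → ∀ e, z j e ≠ 0 → z k e = 0) :
    Module.finrank ℝ T + q ≤ Module.finrank ℝ H := by
  let L : (T × (Fin q → ℝ)) →ₗ[ℝ] H :=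
    { toFun := fun x => ⟨WithLp.toLp 2 (fun e => D e * x.1.1 e) + ∑ k, x.2 k • z k.succ,
        H.add_mem (hDT _ x.1.2) (H.sum_mem fun k _ => H.smul_mem _ (hz _))⟩
      map_add' := fun x y => by
        ext e
        simp [mul_add, add_mul, Finset.sum_add_distrib]
        ring
      map_smul' := fun c x => by
        ext e
        simp [Finset.mul_sum, mul_left_comm, mul_assoc] }
  have hL : Function.Injective L := by
    rw [injective_iff_map_eq_zero]
    rintro ⟨⟨v, hv⟩, a⟩ h0
    have hw : ∀ e, D e * v e + ∑ k, a k * z k.succ e = 0 := by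
      intro e
      have h1 := congrArg (fun y : H => (y : EuclideanSpace ℝ ι) e) h0
      simpa [L] using h1
    have ha : ∀ n : ℕ, ∀ k : Fin q, (k : ℕ) = n → a k = 0 := by
      intro n
      induction n using Nat.strong_induction_on with
      | _ n ih =>
        rintro k rfl
        obtain ⟨e₀, h1, h2, h3⟩ := hcons k.castSucc k.succ (by simp)
        -- On the support of the cycle preceding `z k.succ` only the coefficient `a k` is visible.
        have hsum : ∀ e, z k.castSucc e ≠ 0 → ∑ i, a i * z i.succ e = a k * z k.succ e := by
          intro e he
          refine Finset.sum_eq_single k (fun i _ hik => ?_) (by simp)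
          rcases lt_or_gt_of_ne (fun h => hik (Fin.ext h) : (i : ℕ) ≠ k) with h | h
          · rw [ih i h i rfl, zero_mul]
          · rw [hnon k.castSucc i.succ (by simpa using h) e he, mul_zero]
        have hoff : ∀ e, e ≠ e₀ → z k.castSucc e * v e = 0 := by
          intro e hne
          by_cases he : z k.castSucc e = 0
          · rw [he, zero_mul]
          have hk : z k.succ e = 0 := by
            by_contra hk
            exact hne (h3 e he hk)
          have h4 := hw e
          rw [hsum e he, hk, mul_zero, add_zero] at h4
          rcases mul_eq_zero.1 h4 with h5 | h5
          · rw [hD v hv e h5, mul_zero]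
          · rw [h5, mul_zero]
        have horth : ∑ e, z k.castSucc e * v e = 0 := by
          have h4 := (Submodule.mem_orthogonal H v).1 (hTH hv) _ (hz k.castSucc)
          simpa [PiLp.inner_apply, mul_comm] using h4
        rw [Finset.sum_eq_single e₀ (fun e _ hne => hoff e hne) (by simp)] at horth
        have hv0 : v e₀ = 0 := (mul_eq_zero.1 horth).resolve_left h1
        have h4 := hw e₀
        rw [hsum e₀ h1, hv0, mul_zero, zero_add] at h4
        exact (mul_eq_zero.1 h4).resolve_right h2
    have ha0 : a = 0 := funext fun k => ha k k rfl
    have hv0 : v = 0 := by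
      ext e
      have h1 := hw e
      simp only [ha0, Pi.zero_apply, zero_mul, Finset.sum_const_zero, add_zero] at h1
      exact (mul_eq_zero.1 h1).elim (hD v hv e) id
    subst ha0 hv0
    rfl
  simpa using LinearMap.finrank_le_finrank_of_injective hL

/-- The bound of `finrank_add_le_of_chain_succ` for chains that may be empty. -/
theorem finrank_add_le_of_chain {ι : Type*} [Fintype ι]
    (H T : Submodule ℝ (EuclideanSpace ℝ ι)) (D : ι → ℝ) (hTH : T ≤ Hᗮ)
    (hDT : ∀ v ∈ T, WithLp.toLp 2 (fun e => D e * v e) ∈ H)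
    (hD : ∀ v ∈ T, ∀ e, D e = 0 → v e = 0)
    {p : ℕ} (z : Fin p → EuclideanSpace ℝ ι) (hz : ∀ j, z j ∈ H)
    (hcons : ∀ j k : Fin p, (j : ℕ) + 1 = k →
      ∃ e, z j e ≠ 0 ∧ z k e ≠ 0 ∧ ∀ e', z j e' ≠ 0 → z k e' ≠ 0 → e' = e)
    (hnon : ∀ j k : Fin p, (j : ℕ) + 1 < k → ∀ e, z j e ≠ 0 → z k e = 0) :
    Module.finrank ℝ T + p ≤ Module.finrank ℝ H + 1 := by
  cases p with
  | zero =>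
    have h := finrank_add_le_of_chain_succ H T D hTH hDT hD (q := 0) (fun _ => 0)
      (fun _ => H.zero_mem) (fun j k h => by omega) (fun j k h => by omega)
    omega
  | succ q =>
    have h := finrank_add_le_of_chain_succ H T D hTH hDT hD z hz hcons hnon
    omega

/-! ### Cycle vectors -/

namespace SimpleGraph

variable {V : Type*}

/-- The coefficient of an oriented edge in the traversal of it that ends at `v`: it is `1` if the
traversal agrees with the orientation and `-1` otherwise. -/
noncomputable def EdgeOrientation.sign [DecidableEq V] {G : SimpleGraph V} (o : G.EdgeOrientation)
    (e : G.edgeSet) (v : V) : ℝ := if o.tgt e = v then 1 else -1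

/-- The 1-chain of a walk: the sum of its traversed edges, signed by the orientation. -/
noncomputable def EdgeOrientation.walkChain [DecidableEq V] {G : SimpleGraph V}
    (o : G.EdgeOrientation) : ∀ {u v : V}, G.Walk u v → G.edgeSet → ℝ
  | _, _, .nil => 0
  | u, _, .cons (v := v) h p =>
      Pi.single (⟨s(u, v), h⟩ : G.edgeSet) (o.sign ⟨s(u, v), h⟩ v) + o.walkChain p

namespace EdgeOrientation

variable [DecidableEq V] {G : SimpleGraph V} (o : G.EdgeOrientation)

theorem incidence_mul_sign {u v : V} (h : G.Adj u v) (i : V) :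
    o.incidence i ⟨s(u, v), h⟩ * o.sign ⟨s(u, v), h⟩ v =
      (if i = v then 1 else 0) - (if i = u then 1 else 0) := by
  have he := o.edge_eq ⟨s(u, v), h⟩
  have hne : u ≠ v := h.ne
  simp only [incidence, Matrix.of_apply, sign]
  rcases Sym2.eq_iff.1 he with ⟨h1, h2⟩ | ⟨h1, h2⟩
  · rw [h1, h2, if_pos rfl, mul_one]
  · rw [h1, h2, if_neg hne]
    ring

/-- The boundary of the chain of a walk is its end minus its start. -/
theorem incidence_walkChain [Fintype G.edgeSet] {u v : V} (w : G.Walk u v) (i : V) :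
    ∑ e, o.incidence i e * o.walkChain w e =
      (if i = v then 1 else 0) - (if i = u then 1 else 0) := by
  induction w with
  | nil => simp [walkChain]
  | cons h p ih =>
    simp only [walkChain, Pi.add_apply, mul_add, Finset.sum_add_distrib, ih]
    rw [Finset.sum_eq_single ⟨_, h⟩ (fun e _ he => by rw [Pi.single_eq_of_ne he, mul_zero])
      (by simp), Pi.single_eq_same, incidence_mul_sign]
    ring

theorem walkChain_eq_zero {u v : V} (w : G.Walk u v) (e : G.edgeSet) (he : (e : Sym2 V) ∉ w.edges) :
    o.walkChain w e = 0 := by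
  induction w with
  | nil => rfl
  | cons h p ih =>
    rw [Walk.edges_cons, List.mem_cons, not_or] at he
    simp only [walkChain, Pi.add_apply]
    rw [ih he.2, Pi.single_eq_of_ne (fun h' => he.1 (congrArg Subtype.val h')), add_zero]

/-- A walk without repeated edges has no cancellation in its chain. -/
theorem walkChain_ne_zero {u v : V} (w : G.Walk u v) (hw : w.edges.Nodup) (e : G.edgeSet)
    (he : (e : Sym2 V) ∈ w.edges) : o.walkChain w e ≠ 0 := by
  induction w with
  | nil => simp at he
  | @cons a b c h p ih =>
    rw [Walk.edges_cons, List.nodup_cons] at hw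
    rw [Walk.edges_cons, List.mem_cons] at he
    simp only [walkChain, Pi.add_apply]
    by_cases hep : (e : Sym2 V) = s(a, b)
    · obtain rfl : e = ⟨s(a, b), h⟩ := Subtype.ext hep
      rw [Pi.single_eq_same, o.walkChain_eq_zero p _ hw.1, add_zero, sign]
      split_ifs <;> norm_num
    · rw [Pi.single_eq_of_ne (fun h' => hep (congrArg Subtype.val h')), zero_add]
      exact ih hw.2 (he.resolve_left hep)

variable [Fintype V] [DecidableRel G.Adj]

theorem mem_homologyOne_iff (y : EuclideanSpace ℝ G.edgeSet) :
    y ∈ o.homologyOne ↔ ∀ i, ∑ e, o.incidence i e * y e = 0 := by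
  rw [homologyOne, LinearMap.mem_ker, Matrix.toLpLin_apply]
  constructor
  · intro h i
    simpa [Matrix.mulVec, dotProduct] using congrArg (fun x : EuclideanSpace ℝ V => x i) h
  · intro h
    ext i
    simpa [Matrix.mulVec, dotProduct] using h i

theorem exists_cycleVector {H : G.Subgraph} (hH : H.IsCycleSubgraph) :
    ∃ z ∈ o.homologyOne, ∀ e : G.edgeSet, z e ≠ 0 ↔ (e : Sym2 V) ∈ H.edgeSet := by
  obtain ⟨v, w, hw, rfl⟩ := hH
  refine ⟨WithLp.toLp 2 (o.walkChain w), ?_, fun e => ?_⟩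
  · rw [mem_homologyOne_iff]
    intro i
    simpa using o.incidence_walkChain w i
  · rw [Walk.mem_edges_toSubgraph]
    exact ⟨fun h => by_contra fun h' => h (o.walkChain_eq_zero w e h'),
      o.walkChain_ne_zero w hw.edges_nodup e⟩

/-- Any cycle chain bounds the dimension of a space `T` of infinitesimal deformations of an
equilibrium, where `D` is the diagonal of the linearized coupling and is injective on `T`. -/
theorem finrank_add_le_of_isCycleChain (T : Submodule ℝ (EuclideanSpace ℝ G.edgeSet))
    (D : G.edgeSet → ℝ) (hTH : T ≤ o.homologyOneᗮ)
    (hDT : ∀ v ∈ T, WithLp.toLp 2 (fun e => D e * v e) ∈ o.homologyOne)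
    (hD : ∀ v ∈ T, ∀ e, D e = 0 → v e = 0) {p : ℕ} {C : Fin p → G.Subgraph}
    (hC : G.IsCycleChain C) :
    Module.finrank ℝ T + p ≤ Module.finrank ℝ o.homologyOne + 1 := by
  choose z hz hsupp using fun j => o.exists_cycleVector (hC.isCycle j)
  refine finrank_add_le_of_chain _ T D hTH hDT hD z hz (fun j k hjk => ?_) (fun j k hjk e he => ?_)
  · obtain ⟨e, he⟩ := Set.ncard_eq_one.1 (hC.consecutive j k hjk)
    have hmem : e ∈ (C j).edgeSet ∩ (C k).edgeSet := he ▸ Set.mem_singleton e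
    refine ⟨⟨e, (C j).edgeSet_subset hmem.1⟩, (hsupp j _).2 hmem.1, (hsupp k _).2 hmem.2,
      fun e' h1 h2 => Subtype.ext ?_⟩
    have h3 : (e' : Sym2 V) ∈ (C j).edgeSet ∩ (C k).edgeSet := ⟨(hsupp j _).1 h1, (hsupp k _).1 h2⟩
    rwa [he] at h3
  · by_contra hk
    have h3 : (e : Sym2 V) ∈ (C j).edgeSet ∩ (C k).edgeSet := ⟨(hsupp j _).1 he, (hsupp k _).1 hk⟩
    rwa [hC.nonconsecutive j k hjk] at h3

end EdgeOrientation

end SimpleGraph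

/-! ### Tangent vectors to the set of equilibria -/

/-- The critical points of a function in `OddAnalytic` are isolated. -/
theorem OddAnalytic.eventually_deriv_ne_zero {f : ℝ → ℝ} (hf : f ∈ OddAnalytic) (c : ℝ) :
    ∀ᶠ x in 𝓝[≠] c, deriv f x ≠ 0 := by
  obtain ⟨hconst, -, han⟩ := hf
  have hd : AnalyticOnNhd ℝ (deriv f) Set.univ := han.deriv
  refine (hd c trivial).eventually_eq_zero_or_eventually_ne_zero.resolve_left fun h => hconst ?_
  have h0 : ∀ x, deriv f x = 0 := fun x =>
    hd.eqOn_zero_of_preconnected_of_eventuallyEq_zero isPreconnected_univ trivial h trivial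
  exact ⟨f 0, fun x => is_const_of_deriv_eq_zero
    (fun y => (han y trivial).differentiableAt) h0 x 0⟩

/-- A smooth submanifold has, at each point, a `d`-dimensional space of velocities of curves in
it. -/
theorem IsSmoothSubmanifold.exists_tangent {E : Type*} [NormedAddCommGroup E] [NormedSpace ℝ E]
    {d : ℕ} {M : Set E} (hM : IsSmoothSubmanifold d M) {x : E} (hx : x ∈ M) :
    ∃ T : Submodule ℝ E, Module.finrank ℝ T = d ∧ ∀ v ∈ T, ∃ γ : ℝ → E,
      γ 0 = x ∧ HasDerivAt γ v 0 ∧ ∀ᶠ t in 𝓝 (0 : ℝ), γ t ∈ M := by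
  obtain ⟨Φ, F, hxs, hΦ, hΨ, -, hFd, himg⟩ := hM x hx
  have hut : Φ x ∈ Φ.target := Φ.map_source hxs
  have huF : Φ x ∈ F := (himg ▸ Set.mem_image_of_mem Φ ⟨hxs, hx⟩ : Φ x ∈ Φ.target ∩ (F : Set E)).2
  have hdΨ : DifferentiableAt ℝ Φ.symm (Φ x) :=
    (hΨ.contDiffAt (Φ.open_target.mem_nhds hut)).differentiableAt (by simp)
  have hdΦ : DifferentiableAt ℝ Φ x :=
    (hΦ.contDiffAt (Φ.open_source.mem_nhds hxs)).differentiableAt (by simp)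
  set A := fderiv ℝ Φ.symm (Φ x) with hA
  have hAinj : Function.Injective A := by
    have h1 : HasFDerivAt (Φ ∘ Φ.symm) ((fderiv ℝ Φ x).comp A) (Φ x) := by
      refine HasFDerivAt.comp _ ?_ hdΨ.hasFDerivAt
      rw [Φ.left_inv hxs]
      exact hdΦ.hasFDerivAt
    have h2 : HasFDerivAt (Φ ∘ Φ.symm) (ContinuousLinearMap.id ℝ E) (Φ x) :=
      (hasFDerivAt_id _).congr_of_eventuallyEq (by
        filter_upwards [Φ.open_target.mem_nhds hut] with y hy using Φ.right_inv hy)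
    have h3 := h1.unique h2
    exact Function.LeftInverse.injective (g := fderiv ℝ Φ x) fun y => by
      simpa using congrArg (fun B : E →L[ℝ] E => B y) h3
  refine ⟨F.map (A : E →ₗ[ℝ] E), ?_, ?_⟩
  · rw [← hFd]
    exact (Submodule.equivMapOfInjective (A : E →ₗ[ℝ] E) hAinj F).finrank_eq.symm
  · rintro _ ⟨h, hh, rfl⟩
    have hline : HasDerivAt (fun t : ℝ => Φ x + t • h) h 0 := by
      simpa using ((hasDerivAt_id (0 : ℝ)).smul_const h).const_add (Φ x)
    refine ⟨fun t => Φ.symm (Φ x + t • h), by simp [Φ.left_inv hxs], ?_, ?_⟩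
    · refine HasFDerivAt.comp_hasDerivAt (0 : ℝ) ?_ hline
      simpa using hdΨ.hasFDerivAt
    · have hc : Tendsto (fun t : ℝ => Φ x + t • h) (𝓝 0) (𝓝 (Φ x)) := by
        simpa using hline.continuousAt.tendsto
      filter_upwards [hc.eventually (Φ.open_target.mem_nhds hut)] with t ht
      have h1 : Φ x + t • h ∈ Φ '' (Φ.source ∩ M) :=
        himg ▸ ⟨ht, F.add_mem huF (F.smul_mem t hh)⟩
      obtain ⟨y, ⟨hys, hyM⟩, hy⟩ := h1
      rw [← hy, Φ.left_inv hys]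
      exact hyM

/-- Every non-empty set of edge vectors has a point near which, within the set, the critical
coordinates of `f` are the same as at that point. -/
theorem exists_eventually_deriv_eq_zero {ι : Type*} [Fintype ι] {f : ℝ → ℝ}
    (hf : Continuous (deriv f)) {M : Set (EuclideanSpace ℝ ι)} (hM : M.Nonempty) :
    ∃ x ∈ M, ∀ᶠ y in 𝓝[M] x, ∀ e, deriv f (x e) = 0 → deriv f (y e) = 0 := by
  classical
  let S : EuclideanSpace ℝ ι → Finset ι := fun x => {e | deriv f (x e) ≠ 0}
  -- A point with the largest number of non-critical coordinates works, since these stay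
  -- non-critical nearby.
  have hfin : ((fun x => (S x).card) '' M).Finite :=
    (Set.finite_Iic (Fintype.card ι)).subset (by
      rintro _ ⟨x, -, rfl⟩
      exact Finset.card_le_univ _)
  obtain ⟨x, hx, hmax⟩ := hfin.exists_maximalFor' (fun x => (S x).card) M hM
  refine ⟨x, hx, ?_⟩
  have hev : ∀ᶠ y in 𝓝[M] x, ∀ e, deriv f (x e) ≠ 0 → deriv f (y e) ≠ 0 := by
    refine eventually_all.2 fun e => ?_
    by_cases he : deriv f (x e) = 0
    · simp [he]
    · have hc : Continuous fun y : EuclideanSpace ℝ ι => deriv f (y e) := by fun_prop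
      filter_upwards [nhdsWithin_le_nhds (hc.continuousAt.eventually_ne he)] with y hy _ using hy
  filter_upwards [hev, self_mem_nhdsWithin] with y hy hyM e he
  by_contra hne
  have hsub : S x ⊆ S y := fun e' he' => by
    simp only [S, Finset.mem_filter, Finset.mem_univ, true_and] at he' ⊢
    exact hy e' he'
  have hle : (S y).card ≤ (S x).card := by
    rcases le_total (S x).card (S y).card with h | h
    · exact hmax hyM h
    · exact h
  have heq := Finset.eq_of_subset_of_card_le hsub hle
  have : e ∈ S x := by
    rw [heq]
    simp [S, hne]
  simp [S, he] at this

namespace SimpleGraph.EdgeOrientation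

variable {V : Type*} [Fintype V] [DecidableEq V] {G : SimpleGraph V} [DecidableRel G.Adj]
  (o : G.EdgeOrientation)

/-- Each submanifold of the set of equilibria and each cycle chain satisfy the dimension bound. The
linear estimate applies to the tangent space at a point given by `exists_eventually_deriv_eq_zero`;
there, a coordinate that is critical for `f` is constant along all curves in the submanifold. -/
theorem add_le_of_isSmoothSubmanifold {f : ℝ → ℝ} (hf : f ∈ OddAnalytic) {d : ℕ}
    {M : Set (EuclideanSpace ℝ G.edgeSet)} (hne : M.Nonempty) (hsub : M ⊆ o.equilibria f)
    (hM : IsSmoothSubmanifold d M) {p : ℕ} {C : Fin p → G.Subgraph} (hC : G.IsCycleChain C) :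
    d + p ≤ Module.finrank ℝ o.homologyOne + 1 := by
  have han := hf.2.2
  have hcont : Continuous (deriv f) := continuousOn_univ.1 han.deriv.continuousOn
  obtain ⟨x, hx, hcrit⟩ := exists_eventually_deriv_eq_zero hcont hne
  obtain ⟨T, hTd, hT⟩ := hM.exists_tangent hx
  rw [← hTd]
  have hcoord : ∀ {γ : ℝ → EuclideanSpace ℝ G.edgeSet} {v}, HasDerivAt γ v 0 →
      ∀ e, HasDerivAt (fun t => γ t e) (v e) 0 := fun hγ e =>
    (EuclideanSpace.proj (𝕜 := ℝ) e).hasFDerivAt.comp_hasDerivAt (0 : ℝ) hγ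
  refine o.finrank_add_le_of_isCycleChain T (fun e => deriv f (x e)) ?_ ?_ ?_ hC
  · intro v hv
    obtain ⟨γ, -, hγ, hγM⟩ := hT v hv
    rw [Submodule.mem_orthogonal]
    intro z hz
    have h1 : HasDerivAt (fun t => inner ℝ z (γ t)) (inner ℝ z v) 0 :=
      (innerSL ℝ z).hasFDerivAt.comp_hasDerivAt (0 : ℝ) hγ
    refine h1.unique ((hasDerivAt_const (0 : ℝ) (0 : ℝ)).congr_of_eventuallyEq ?_)
    filter_upwards [hγM] with t ht
    exact (Submodule.mem_orthogonal _ _).1 (hsub ht).2 z hz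
  · intro v hv
    obtain ⟨γ, rfl, hγ, hγM⟩ := hT v hv
    rw [mem_homologyOne_iff]
    intro i
    have h1 : HasDerivAt (fun t => ∑ e, o.incidence i e * f (γ t e))
        (∑ e, o.incidence i e * (deriv f (γ 0 e) * v e)) 0 :=
      HasDerivAt.fun_sum fun e _ => HasDerivAt.const_mul _
        ((han (γ 0 e) trivial).differentiableAt.hasDerivAt.comp (0 : ℝ) (hcoord hγ e))
    refine h1.unique ((hasDerivAt_const (0 : ℝ) (0 : ℝ)).congr_of_eventuallyEq ?_)
    filter_upwards [hγM] with t ht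
    exact (o.mem_homologyOne_iff _).1 (hsub ht).1 i
  · intro v hv e he
    obtain ⟨γ, rfl, hγ, hγM⟩ := hT v hv
    have hγe := hcoord hγ e
    have hlim : Tendsto γ (𝓝 0) (𝓝[M] γ 0) :=
      tendsto_nhdsWithin_iff.2 ⟨hγ.continuousAt.tendsto, hγM⟩
    -- Along the curve the `e`-th coordinate stays in the discrete set of critical points of `f`.
    have hconst : ∀ᶠ t in 𝓝 (0 : ℝ), γ t e = γ 0 e := by
      have hiso := eventually_nhdsWithin_iff.1 (OddAnalytic.eventually_deriv_ne_zero hf (γ 0 e))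
      filter_upwards [hlim.eventually hcrit, hγe.continuousAt.tendsto.eventually hiso]
        with t h1 h2
      by_contra h3
      exact h2 h3 (h1 e he)
    exact hγe.unique ((hasDerivAt_const (0 : ℝ) (γ 0 e)).congr_of_eventuallyEq hconst)

end SimpleGraph.EdgeOrientation

theorem mainTheorem2 {V : Type*} [Fintype V] [DecidableEq V] (G : SimpleGraph V)
    [DecidableRel G.Adj] (o : G.EdgeOrientation) (f : ℝ → ℝ) (hf : f ∈ OddAnalytic)
    (hfib : IsPeriodic f ∨ HasFiniteFibers f) :
    manifoldDim (o.equilibria f) + ((G.cc : ℕ∞) : WithBot ℕ∞) ≤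
      ((Module.finrank ℝ o.homologyOne : ℕ∞) : WithBot ℕ∞) + 1 := by
  set n := Module.finrank ℝ o.homologyOne with hn
  have hcc : ∀ d : ℕ, (∀ p (C : Fin p → G.Subgraph), G.IsCycleChain C → d + p ≤ n + 1) →
      (d : ℕ∞) + G.cc ≤ ((n + 1 : ℕ) : ℕ∞) := by
    intro d hd
    have hd0 : d ≤ n + 1 := hd 0 (fun j => j.elim0)
      ⟨fun j => j.elim0, fun j => j.elim0, fun j => j.elim0⟩
    have h1 : G.cc ≤ ((n + 1 - d : ℕ) : ℕ∞) := by
      refine iSup₂_le fun p hp => ?_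
      obtain ⟨C, hC⟩ := hp
      have := hd p C hC
      exact_mod_cast (by omega : p ≤ n + 1 - d)
    calc (d : ℕ∞) + G.cc ≤ d + ((n + 1 - d : ℕ) : ℕ∞) := by gcongr
      _ = ((n + 1 : ℕ) : ℕ∞) := by
        rw [← Nat.cast_add, Nat.add_sub_cancel' hd0]
  -- The zero tangent space shows that `cc G` is finite.
  have hcc0 : G.cc ≤ ((n + 1 : ℕ) : ℕ∞) := by
    have h := hcc 0 fun p C hC => by
      have h := o.finrank_add_le_of_isCycleChain ⊥ 0 bot_le (by simp [← Pi.zero_def])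
        (by simp) hC
      simpa using h
    simpa using h
  obtain ⟨c, hc⟩ := ENat.ne_top_iff_exists.1 (ne_top_of_le_ne_top (ENat.natCast_ne_top _) hcc0)
  have hcn : c ≤ n + 1 := by
    rw [← hc] at hcc0
    exact_mod_cast hcc0
  have hdim : manifoldDim (o.equilibria f) ≤ (((n + 1 - c : ℕ) : ℕ∞) : WithBot ℕ∞) := by
    refine iSup₂_le fun d hd => ?_
    obtain ⟨M, hne, hsub, hM⟩ := hd
    have h := hcc d fun p C hC => o.add_le_of_isSmoothSubmanifold hf hne hsub hM hC
    rw [← hc] at h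
    have h' : d + c ≤ n + 1 := by exact_mod_cast h
    rw [WithBot.coe_le_coe]
    exact_mod_cast (by omega : d ≤ n + 1 - c)
  calc manifoldDim (o.equilibria f) + ((G.cc : ℕ∞) : WithBot ℕ∞)
      ≤ (((n + 1 - c : ℕ) : ℕ∞) : WithBot ℕ∞) + ((c : ℕ∞) : WithBot ℕ∞) := by
        rw [← hc]
        gcongr
    _ = ((n : ℕ∞) : WithBot ℕ∞) + 1 := by
        rw [← WithBot.coe_add, ← Nat.cast_add, Nat.sub_add_cancel hcn]
        push_cast
        rfl
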